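/- \textbf{Setting.} Let $\Omega,\widetilde\Omega$ be Polish spaces and let $\mathfrak P(\widetilde\Omega)$ be the space of Borel probability measures on $\widetilde\Omega$ with the weak topology. For each $\omega\in\Omega$ let $\mathcal P(\omega)\subset\mathfrak P(\widetilde\Omega)$ be non-empty, and assume that $\{(\omega,P): P\in\mathcal P(\omega)\}$ is an analytic subset of $\Omega\times\mathfrak P(\widetilde\Omega)$. A property of $\tilde\omega\in\widetilde\Omega$ holds $\mathcal P(\omega)$-q.s. if it holds outside some Borel set $A$ with $P(A)=0$ for all $P\in\mathcal P(\omega)$. Let $y:\Omega\to\mathbb R_+^d$ and $Y:\Omega\times\widetilde\Omega\to\mathbb R_+^d$ be Borel measurable. Let the quasi-sure support $$S(\omega)=\operatorname{supp}_{\mathcal P}Y(\omega)=\bigcap\{F\subset\mathbb R^d \text{ closed}:\ P(Y(\omega,\cdot)\in F)=1\ \ \forall P\in\mathcal P(\omega)\}$$ be non-empty for every $\omega$. Let $g:\Omega\times\mathbb R^d\to\mathbb R\cup\{+\infty\}$ be upper semianalytic, i.e. $\{g>c\}$ is analytic for every $c\in\mathbb R$; real-valued $g$ are included. We write $\theta z$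 for the scalar product, $\delta_C=0$ on $C$ and $\delta_C=+\infty$ off $C$. For $Z:\Omega\times\widetilde\Omega\to\mathbb R\cup\{+\infty\}$ let $\operatorname{ess\,sup}_{\mathcal P}(Z)(\omega)$ be the least element of $[-\infty,+\infty]$ that dominates $Z(\omega,\cdot)$ $\mathcal P(\omega)$-q.s. Let $$\Pi(g)(\omega)=\{x\in\mathbb R:\ \exists\,\theta\in\mathbb R^d,\ x+\theta\,(Y(\omega,\cdot)-y(\omega))\ge g(\omega,Y(\omega,\cdot))\ \ \mathcal P(\omega)\text{-q.s.}\}$$ be the set of super-hedging prices and $\pi(g)(\omega)=\inf\Pi(g)(\omega)\in[-\infty,+\infty]$ (with $\inf\emptyset=+\infty$). \textbf{Theorem.} Fix $\omega\in\Omega$. (1) We have $$\Pi(g)(\omega)=\Big(\big\{\operatorname{ess\,sup}_{\mathcal P}(g(Y)-\theta Y)(\omega)+\theta y(\omega):\ \theta\in\mathbb R^d\big\}+\mathbb R_+\Big)\cap\mathbb R.$$ (2) Suppose that $g(\omega,\cdot)$ is lower semicontinuous. Then for every $\theta\in\mathbb R^d$ $$\operatorname{ess\,sup}_{\mathcal P}(g(Y)-\theta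 Y)(\omega)=\sup_{z\in S(\omega)}\big(g(\omega,z)-\theta z\big)=f^*(\omega,-\theta),$$ where $f(\omega,z)=-g(\omega,z)$ for $z\in S(\omega)$, $f(\omega,z)=+\infty$ for $z\notin S(\omega)$ (that is, $f=-g+\delta_{S}$), and $f^*(\omega,x)=\sup_{z\in\mathbb R^d}(xz-f(\omega,z))$. (3) Suppose moreover that $g(\omega,\cdot)$ is proper (finite at some point and never $-\infty$) and that there is a finite concave function $\varphi$ on $\operatorname{conv}S(\omega)$ with $g(\omega,\cdot)\le\varphi$ on $\operatorname{conv}S(\omega)$. Let $f^{**}(\omega,x)=\sup_{z\in\mathbb R^d}(xz-f^*(\omega,z))$, let $$\operatorname{conc}(\omega,x)=\inf\{v(x):\ v:\mathbb R^d\to[-\infty,+\infty]\text{ concave},\ v(z)\ge g(\omega,z)\ \ \forall z\in S(\omega)\}$$ be the relative concave envelope of $g(\omega,\cdot)$ with respect to $S(\omega)$ ($v$ is concave if $\{(x,t)\in\mathbb R^d\times\mathbb R: t\le v(x)\}$ is convex), and for $h:\mathbb R^d\to[-\infty,+\infty]$ let $\overline h(x)=\limsup_{u\to x}h(u)$ be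 its upper closure (the point $u=x$ is included in the limsup). Then $$\pi(g)(\omega)=-f^{**}(\omega,y(\omega))=\overline{\big(\operatorname{conc}(\omega,\cdot)-\delta_{\operatorname{conv}S(\omega)}\big)}(y(\omega))=\overline{\operatorname{conc}}(\omega,y(\omega))-\delta_{\overline{\operatorname{conv}}\,S(\omega)}(y(\omega)),$$ where $\overline{\operatorname{conv}}\,S(\omega)$ is the closure of $\operatorname{conv}S(\omega)$. In particular, if $y(\omega)$ is not in $\overline{\operatorname{conv}}\,S(\omega)\setminus\operatorname{conv}S(\omega)$ (for instance if $\operatorname{conv}S(\omega)$ is closed), then $$\pi(g)(\omega)=\overline{\operatorname{conc}}(\omega,y(\omega))-\delta_{\operatorname{conv}S(\omega)}(y(\omega)).$$ -/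

import Mathlib

open MeasureTheory
open scoped Pointwise Topology

namespace QuasiSure

section Priors

variable {T : Type*} [MeasurableSpace T]

/-- A set is polar for a family of priors if it lies in one Borel set that is null
for every prior of the family. -/
def IsPolar (𝔓 : Set (ProbabilityMeasure T)) (N : Set T) : Prop :=
  ∃ A : Set T, MeasurableSet A ∧ N ⊆ A ∧ ∀ P ∈ 𝔓, (P : Measure T) A = 0

/-- A property holds quasi-surely if it holds outside a polar set. -/
def QuasiSurely (𝔓 : Set (ProbabilityMeasure T)) (p : T → Prop) : Prop :=
  IsPolar 𝔓 {t | ¬ p t}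

/-- The quasi-sure support: the intersection of all closed sets that carry the law of `X`
under every prior. -/
def qsSupport {E : Type*} [TopologicalSpace E]
    (𝔓 : Set (ProbabilityMeasure T)) (X : T → E) : Set E :=
  ⋂₀ {F : Set E | IsClosed F ∧ ∀ P ∈ 𝔓, (P : Measure T) {t | X t ∈ F} = 1}

/-- The quasi-sure essential supremum: the least extended real number that dominates `Z`
quasi-surely. The three facts below show that it dominates `Z` quasi-surely, that a real
number dominates `Z` quasi-surely if and only if it dominates this number, and that the
second property determines it. -/
noncomputable def qsEssSup (𝔓 : Set (ProbabilityMeasure T)) (Z : T → EReal) : EReal :=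
  sInf {x : EReal | QuasiSurely 𝔓 fun t => Z t ≤ x}

theorem le_qsEssSup (𝔓 : Set (ProbabilityMeasure T)) (Z : T → EReal) :
    QuasiSurely 𝔓 fun t => Z t ≤ qsEssSup 𝔓 Z := by
  have hne : {x : EReal | QuasiSurely 𝔓 fun t => Z t ≤ x}.Nonempty :=
    ⟨⊤, ∅, MeasurableSet.empty, by simp, by simp⟩
  obtain ⟨u, -, hu, hmem⟩ := exists_seq_tendsto_sInf hne (OrderBot.bddBelow _)
  choose A hA hsub hnull using hmem
  refine ⟨⋃ n, A n, MeasurableSet.iUnion hA, ?_, ?_⟩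
  · intro t ht
    by_contra hcon
    apply ht
    refine ge_of_tendsto' hu fun n => ?_
    by_contra hn
    exact hcon (Set.mem_iUnion.2 ⟨n, hsub n hn⟩)
  · intro P hP
    exact measure_iUnion_null fun n => hnull n P hP

theorem qsEssSup_le_iff (𝔓 : Set (ProbabilityMeasure T)) (Z : T → EReal) (x : ℝ) :
    (QuasiSurely 𝔓 fun t => Z t ≤ (x : EReal)) ↔ qsEssSup 𝔓 Z ≤ (x : EReal) := by
  constructor
  · intro h
    exact sInf_le h
  · intro h
    obtain ⟨A, hA, hsub, hnull⟩ := le_qsEssSup 𝔓 Z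
    exact ⟨A, hA, fun t ht => hsub fun h' => ht (le_trans h' h), hnull⟩

theorem eq_qsEssSup (𝔓 : Set (ProbabilityMeasure T)) (Z : T → EReal) (s : EReal)
    (hs : ∀ x : ℝ, (QuasiSurely 𝔓 fun t => Z t ≤ (x : EReal)) ↔ s ≤ (x : EReal)) :
    s = qsEssSup 𝔓 Z := by
  apply le_antisymm
  · refine EReal.le_of_forall_lt_iff_le.1 fun x hx => ?_
    exact (hs x).1 ((qsEssSup_le_iff 𝔓 Z x).2 hx.le)
  · refine EReal.le_of_forall_lt_iff_le.1 fun x hx => ?_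
    exact (qsEssSup_le_iff 𝔓 Z x).1 ((hs x).2 hx.le)

/-- The super-hedging prices of the claim `Z` when the initial prices are `y` and the final
prices are `Y`. -/
def superHedgingPrices {d : ℕ} (𝔓 : Set (ProbabilityMeasure T))
    (y : EuclideanSpace ℝ (Fin d)) (Y : T → EuclideanSpace ℝ (Fin d)) (Z : T → EReal) :
    Set ℝ :=
  {x : ℝ | ∃ θ : EuclideanSpace ℝ (Fin d),
    QuasiSurely 𝔓 fun t => Z t ≤ ((x + inner ℝ θ (Y t - y) : ℝ) : EReal)}

/-- The infimum super-hedging cost (`⊤` if there is no super-hedging price). -/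
noncomputable def superHedgingCost {d : ℕ} (𝔓 : Set (ProbabilityMeasure T))
    (y : EuclideanSpace ℝ (Fin d)) (Y : T → EuclideanSpace ℝ (Fin d)) (Z : T → EReal) :
    EReal :=
  sInf (Real.toEReal '' superHedgingPrices 𝔓 y Y Z)

end Priors

/-- Upper semianalytic extended real functions. -/
def IsUSA {X : Type*} [TopologicalSpace X] (h : X → EReal) : Prop :=
  ∀ c : ℝ, AnalyticSet {x | (c : EReal) < h x}

section Convex

variable {d : ℕ}

/-- The indicator of convex analysis: `0` on `C` and `+∞` elsewhere. -/
noncomputable def indicatorFn (C : Set (EuclideanSpace ℝ (Fin d)))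
    (z : EuclideanSpace ℝ (Fin d)) : EReal :=
  open Classical in if z ∈ C then 0 else ⊤

/-- The function `-g + δ_C`, where the value off `C` is `+∞`. -/
noncomputable def negRestrict (g : EuclideanSpace ℝ (Fin d) → EReal)
    (C : Set (EuclideanSpace ℝ (Fin d))) (z : EuclideanSpace ℝ (Fin d)) : EReal :=
  open Classical in if z ∈ C then -g z else ⊤

/-- The Fenchel-Legendre conjugate. -/
noncomputable def fenchelConj (f : EuclideanSpace ℝ (Fin d) → EReal)
    (x : EuclideanSpace ℝ (Fin d)) : EReal :=
  ⨆ z : EuclideanSpace ℝ (Fin d), (((inner ℝ x z : ℝ) : EReal) - f z)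

/-- Concavity of an extended real function: its hypograph is convex. -/
def IsConcaveFn (v : EuclideanSpace ℝ (Fin d) → EReal) : Prop :=
  Convex ℝ {p : EuclideanSpace ℝ (Fin d) × ℝ | (p.2 : EReal) ≤ v p.1}

/-- The relative concave envelope of `g` with respect to `C`. -/
noncomputable def concEnvelope (g : EuclideanSpace ℝ (Fin d) → EReal)
    (C : Set (EuclideanSpace ℝ (Fin d))) (x : EuclideanSpace ℝ (Fin d)) : EReal :=
  sInf {r : EReal | ∃ v : EuclideanSpace ℝ (Fin d) → EReal,
    IsConcaveFn v ∧ (∀ z ∈ C, g z ≤ v z) ∧ r = v x}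

/-- The upper closure, the smallest upper semicontinuous function above `h`. -/
noncomputable def upperClosureFn (h : EuclideanSpace ℝ (Fin d) → EReal)
    (x : EuclideanSpace ℝ (Fin d)) : EReal :=
  Filter.limsup h (𝓝 x)

/-- Proper functions: finite somewhere and nowhere `-∞`. -/
def IsProperFn (h : EuclideanSpace ℝ (Fin d) → EReal) : Prop :=
  (∃ x, h x < ⊤) ∧ ∀ x, ⊥ < h x

end Convex

end QuasiSure

/-!
The first part is a rearrangement of inequalities between real numbers; the only point to check is
that the essential supremum is never `⊥`, which holds because `g` is nowhere `⊥` and some prior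
exists (`bot_lt_qsEssSup`).

For the second part, the law of `Y` is carried by its quasi-sure support `S` under every prior,
because the complement of `S` is a countable union of null open sets
(`quasiSurely_mem_qsSupport`). Hence a bound on `S` is a quasi-sure bound. Conversely, lower
semicontinuity makes the set where a bound holds closed, so a quasi-sure bound extends to all
of `S` (`quasiSurely_le_iff`).

For the third part, the super-hedging prices are therefore the values at `y` of the affine
functions that dominate `g` on `S`, and each identity describes the infimum of these values. It
is `-f**(y)` by the definition of the conjugates. That it is the upper closure of the concave
envelope is the Fenchel–Moreau theorem, proved by separating a point `(y, t)` from the closure of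
the hypograph of the envelope (`exists_affine_majorant_lt`). A vertical separating hyperplane is
tilted by adding a large multiple of it to one affine majorant. Such a majorant exists because a
finite concave function on `conv S` is locally bounded above at an intrinsic interior point of
the convex hull of a maximal affinely independent subset of `S`
(`exists_eventually_le_of_concaveOn_convexHull`).
-/

namespace QuasiSure

/-! ### Quasi-sure bounds and the support -/

section Support

variable {T : Type*} [MeasurableSpace T] {𝔓 : Set (ProbabilityMeasure T)}

theorem QuasiSurely.mono {p q : T → Prop} (hp : QuasiSurely 𝔓 p) (h : ∀ t, p t → q t) :
    QuasiSurely 𝔓 q := by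
  obtain ⟨A, hA, hsub, hnull⟩ := hp
  exact ⟨A, hA, fun t ht => hsub fun hpt => ht (h t hpt), hnull⟩

theorem QuasiSurely.exists (h𝔓 : 𝔓.Nonempty) {p : T → Prop} (hp : QuasiSurely 𝔓 p) :
    ∃ t, p t := by
  obtain ⟨P, hP⟩ := h𝔓
  obtain ⟨A, -, hsub, hnull⟩ := hp
  by_contra! hcon
  have hA : A = Set.univ := Set.eq_univ_of_forall fun t => hsub (hcon t)
  have h0 := hnull P hP
  rw [hA, measure_univ] at h0
  exact one_ne_zero h0

theorem bot_lt_qsEssSup (h𝔓 : 𝔓.Nonempty) {Z : T → EReal} (hZ : ∀ t, Z t ≠ ⊥) :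
    ⊥ < qsEssSup 𝔓 Z := by
  obtain ⟨t, ht⟩ := (le_qsEssSup 𝔓 Z).exists h𝔓
  exact (bot_lt_iff_ne_bot.2 (hZ t)).trans_le ht

variable {E : Type*} [TopologicalSpace E]

theorem isClosed_qsSupport (𝔓 : Set (ProbabilityMeasure T)) (X : T → E) :
    IsClosed (qsSupport 𝔓 X) :=
  isClosed_sInter fun _ hF => hF.1

variable [MeasurableSpace E] [BorelSpace E] {X : T → E}

theorem quasiSurely_mem_qsSupport [SecondCountableTopology E] (hX : Measurable X) :
    QuasiSurely 𝔓 fun t => X t ∈ qsSupport 𝔓 X := by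
  refine ⟨{t | X t ∉ qsSupport 𝔓 X}, hX (isClosed_qsSupport 𝔓 X).measurableSet.compl,
    subset_rfl, fun P hP => ?_⟩
  obtain ⟨V, hVc, hVsub, hVeq⟩ := TopologicalSpace.isOpen_sUnion_countable
    (compl '' {F : Set E | IsClosed F ∧ ∀ P ∈ 𝔓, (P : Measure T) {t | X t ∈ F} = 1})
    (by rintro _ ⟨F, hF, rfl⟩; exact hF.1.isOpen_compl)
  have hset : {t | X t ∉ qsSupport 𝔓 X} = ⋃ U ∈ V, X ⁻¹' U := by
    have hcompl : (qsSupport 𝔓 X)ᶜ = ⋃₀ V := by rw [hVeq, qsSupport, Set.compl_sInter]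
    calc {t | X t ∉ qsSupport 𝔓 X} = X ⁻¹' (qsSupport 𝔓 X)ᶜ := rfl
      _ = ⋃ U ∈ V, X ⁻¹' U := by rw [hcompl, Set.preimage_sUnion]
  rw [hset, measure_biUnion_null_iff hVc]
  intro U hU
  obtain ⟨F, hF, rfl⟩ := hVsub hU
  exact (prob_compl_eq_zero_iff (hX hF.1.measurableSet)).2 (hF.2 P hP)

theorem qsSupport_subset_of_quasiSurely (hX : Measurable X) {F : Set E} (hF : IsClosed F)
    (h : QuasiSurely 𝔓 fun t => X t ∈ F) : qsSupport 𝔓 X ⊆ F := by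
  refine Set.sInter_subset_of_mem ⟨hF, fun P hP => ?_⟩
  obtain ⟨A, -, hsub, hnull⟩ := h
  exact (prob_compl_eq_zero_iff (hX hF.measurableSet)).1 (measure_mono_null hsub (hnull P hP))

/-- Quasi-sure bounds on a lower semicontinuous function of `X` are bounds on the support. -/
theorem quasiSurely_le_iff [SecondCountableTopology E] (hX : Measurable X) {h : E → EReal}
    (hh : LowerSemicontinuous h) (x : EReal) :
    (QuasiSurely 𝔓 fun t => h (X t) ≤ x) ↔ ∀ z ∈ qsSupport 𝔓 X, h z ≤ x := by
  constructor
  · intro hq z hz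
    exact qsSupport_subset_of_quasiSurely hX (hh.isClosed_preimage x) hq hz
  · intro hz
    exact (quasiSurely_mem_qsSupport hX).mono fun t ht => hz _ ht

theorem qsEssSup_eq_iSup_qsSupport [SecondCountableTopology E] (hX : Measurable X)
    {h : E → EReal} (hh : LowerSemicontinuous h) :
    qsEssSup 𝔓 (fun t => h (X t)) = ⨆ z ∈ qsSupport 𝔓 X, h z := by
  refine (eq_qsEssSup 𝔓 _ _ fun x => ?_).symm
  rw [quasiSurely_le_iff hX hh, iSup₂_le_iff]

end Support

theorem lowerSemicontinuous_sub_coe {E : Type*} [TopologicalSpace E] {h : E → EReal}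
    (hh : LowerSemicontinuous h) {a : E → ℝ} (ha : Continuous a) :
    LowerSemicontinuous fun z => h z - (a z : EReal) := by
  have hc : Continuous fun z => ((-a z : ℝ) : EReal) :=
    continuous_coe_real_ereal.comp ha.neg
  simp only [sub_eq_add_neg, ← EReal.coe_neg]
  exact hh.add' hc.lowerSemicontinuous fun z =>
    EReal.continuousAt_add (Or.inr (EReal.coe_ne_bot _)) (Or.inr (EReal.coe_ne_top _))

/-! ### Super-hedging prices -/

section Prices

variable {T : Type*} [MeasurableSpace T] {𝔓 : Set (ProbabilityMeasure T)} {d : ℕ}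
  {y : EuclideanSpace ℝ (Fin d)} {Y : T → EuclideanSpace ℝ (Fin d)}

theorem sub_coe_le_coe_iff (a : EReal) (b c : ℝ) :
    a - (b : EReal) ≤ (c : EReal) ↔ a ≤ ((c + b : ℝ) : EReal) := by
  rw [EReal.sub_le_iff_le_add (Or.inl (EReal.coe_ne_bot b)) (Or.inl (EReal.coe_ne_top b)),
    EReal.coe_add]

theorem mem_superHedgingPrices_iff_qsEssSup (Z : T → EReal) (x : ℝ) :
    x ∈ superHedgingPrices 𝔓 y Y Z ↔ ∃ θ : EuclideanSpace ℝ (Fin d),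
      qsEssSup 𝔓 (fun t => Z t - ((inner ℝ θ (Y t) : ℝ) : EReal)) ≤
        ((x - inner ℝ θ y : ℝ) : EReal) := by
  refine exists_congr fun θ => ?_
  rw [← qsEssSup_le_iff]
  have heq : ∀ t, x + inner ℝ θ (Y t - y) = x - inner ℝ θ y + inner ℝ θ (Y t) := fun t => by
    rw [inner_sub_right]; ring
  simp only [sub_coe_le_coe_iff, heq]

theorem superHedgingPrices_eq (h𝔓 : 𝔓.Nonempty) {Z : T → EReal} (hZ : ∀ t, Z t ≠ ⊥) :
    superHedgingPrices 𝔓 y Y Z =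
      Real.toEReal ⁻¹'
        (Set.range (fun θ : EuclideanSpace ℝ (Fin d) =>
            qsEssSup 𝔓 (fun t => Z t - ((inner ℝ θ (Y t) : ℝ) : EReal)) +
              ((inner ℝ θ y : ℝ) : EReal)) +
          Real.toEReal '' Set.Ici 0) := by
  ext x
  rw [mem_superHedgingPrices_iff_qsEssSup, Set.mem_preimage, Set.mem_add]
  simp only [Set.exists_range_iff, Set.exists_mem_image]
  refine exists_congr fun θ => ?_
  have hbot : ⊥ < qsEssSup 𝔓 (fun t => Z t - ((inner ℝ θ (Y t) : ℝ) : EReal)) := by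
    refine bot_lt_qsEssSup h𝔓 fun t => ?_
    rw [sub_eq_add_neg, ← EReal.coe_neg, Ne, EReal.add_eq_bot_iff]
    simp [hZ t]
  generalize qsEssSup 𝔓 (fun t => Z t - ((inner ℝ θ (Y t) : ℝ) : EReal)) = e at hbot
  induction e with
  | bot => exact absurd hbot (lt_irrefl _)
  | top =>
    simp only [top_le_iff, EReal.coe_ne_top, false_iff, not_exists, not_and]
    intro r _ h
    rw [EReal.top_add_coe, EReal.top_add_coe] at h
    exact EReal.coe_ne_top _ h.symm
  | coe e =>
    simp only [← EReal.coe_add, EReal.coe_eq_coe_iff, EReal.coe_le_coe_iff, Set.mem_Ici]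
    constructor
    · intro h
      exact ⟨x - inner ℝ θ y - e, by linarith, by ring⟩
    · rintro ⟨r, hr, h⟩
      linarith

/-- The super-hedging prices are the values at `y` of the affine majorants on the support. -/
theorem mem_superHedgingPrices_iff (hY : Measurable Y)
    {g : EuclideanSpace ℝ (Fin d) → EReal} (hg : LowerSemicontinuous g) (x : ℝ) :
    x ∈ superHedgingPrices 𝔓 y Y (fun t => g (Y t)) ↔ ∃ θ : EuclideanSpace ℝ (Fin d),
      ∀ z ∈ qsSupport 𝔓 Y, g z ≤ ((x + inner ℝ θ (z - y) : ℝ) : EReal) := by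
  rw [mem_superHedgingPrices_iff_qsEssSup]
  refine exists_congr fun θ => ?_
  rw [qsEssSup_eq_iSup_qsSupport (h := fun z => g z - ((inner ℝ θ z : ℝ) : EReal)) hY
    (lowerSemicontinuous_sub_coe hg (by fun_prop)), iSup₂_le_iff]
  refine forall₂_congr fun z _ => ?_
  rw [sub_coe_le_coe_iff, inner_sub_right, sub_add_eq_add_sub, add_sub_assoc]

end Prices

/-! ### Affine majorants of concave functions -/

section Convex

variable {d : ℕ}

/-- Near an interior point `x₀` of a simplex that spans the affine hull of `S`, the reflection
`2 x₀ - u` of a point `u` stays in the simplex, where a concave function is bounded below;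
concavity at the midpoint `x₀` then bounds it above at `u`. -/
theorem exists_eventually_le_of_concaveOn_convexHull {S : Set (EuclideanSpace ℝ (Fin d))}
    (hS : S.Nonempty) {φ : EuclideanSpace ℝ (Fin d) → ℝ}
    (hφ : ConcaveOn ℝ (convexHull ℝ S) φ) :
    ∃ x₀ ∈ convexHull ℝ S, ∃ M : ℝ, ∀ᶠ u in 𝓝 x₀, u ∈ convexHull ℝ S → φ u ≤ M := by
  obtain ⟨t, htS, hspan, hind⟩ := exists_affineIndependent ℝ (EuclideanSpace ℝ (Fin d)) S
  have htfin : t.Finite := finite_set_of_fin_dim_affineIndependent ℝ hind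
  have htne : t.Nonempty := by
    rw [← affineSpan_nonempty (k := ℝ), hspan, affineSpan_nonempty]
    exact hS
  have htC : t ⊆ convexHull ℝ S := htS.trans (subset_convexHull ℝ S)
  obtain ⟨z₀, -, hz₀⟩ := Set.exists_min_image t φ htfin htne
  obtain ⟨x₀, hx₀⟩ := (htne.convexHull (𝕜 := ℝ)).intrinsicInterior (convex_convexHull ℝ t)
  have hx₀t : x₀ ∈ convexHull ℝ t := intrinsicInterior_subset hx₀
  have hx₀S : x₀ ∈ convexHull ℝ S := convexHull_mono htS hx₀t
  refine ⟨x₀, hx₀S, 2 * φ x₀ - φ z₀, ?_⟩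
  obtain ⟨w, hw, rfl⟩ := mem_intrinsicInterior.1 hx₀
  rw [mem_interior_iff_mem_nhds, nhds_subtype, Filter.mem_comap] at hw
  obtain ⟨V, hV, hVt⟩ := hw
  have hrefl : Filter.Tendsto (fun u : EuclideanSpace ℝ (Fin d) => (2 : ℝ) • (w : _) - u)
      (𝓝 (w : EuclideanSpace ℝ (Fin d))) (𝓝 (w : EuclideanSpace ℝ (Fin d))) := by
    have hcont : Continuous fun u : EuclideanSpace ℝ (Fin d) =>
        (2 : ℝ) • (w : EuclideanSpace ℝ (Fin d)) - u := by fun_prop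
    have h := hcont.tendsto (w : EuclideanSpace ℝ (Fin d))
    have heq : (2 : ℝ) • (w : EuclideanSpace ℝ (Fin d)) - w = w := by module
    rwa [heq] at h
  filter_upwards [hrefl hV] with u hu huS
  set u' : EuclideanSpace ℝ (Fin d) := (2 : ℝ) • (w : EuclideanSpace ℝ (Fin d)) - u with hu'
  have huspan : u ∈ affineSpan ℝ (convexHull ℝ t) := by
    rw [affineSpan_convexHull, hspan]
    exact convexHull_subset_affineSpan S huS
  have hu'span : u' ∈ affineSpan ℝ (convexHull ℝ t) := by
    have h := AffineMap.lineMap_mem (2 : ℝ) huspan w.2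
    have heq : AffineMap.lineMap u (w : EuclideanSpace ℝ (Fin d)) (2 : ℝ) = u' := by
      rw [AffineMap.lineMap_apply_module, hu']
      module
    rwa [heq] at h
  have hu't : u' ∈ convexHull ℝ t := hVt (a := ⟨u', hu'span⟩) hu
  obtain ⟨z, hz, hzu⟩ := hφ.exists_le_of_mem_convexHull htC hu't
  have hmid := hφ.2 huS (convexHull_mono htS hu't) (one_half_pos (α := ℝ)).le
    (one_half_pos (α := ℝ)).le (add_halves 1)
  have hw2 : (1 / 2 : ℝ) • u + (1 / 2 : ℝ) • u' = w := by
    rw [hu']; module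
  rw [hw2, smul_eq_mul, smul_eq_mul] at hmid
  have := hz₀ z hz
  linarith

/-- Separation of a point from a hypograph. The coefficient of the vertical coordinate is
nonnegative because the set contains downward half-lines. -/
theorem exists_separation_of_hypograph {C : Set (EuclideanSpace ℝ (Fin d) × ℝ)}
    (hC : Convex ℝ C) (hCne : C.Nonempty) (hdown : ∀ u r r', (u, r) ∈ C → r' ≤ r → (u, r') ∈ C)
    {x : EuclideanSpace ℝ (Fin d)} {t : ℝ} (hxt : (x, t) ∉ closure C) :
    ∃ (p : EuclideanSpace ℝ (Fin d)) (s α : ℝ), 0 ≤ s ∧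
      (∀ u r, (u, r) ∈ C → inner ℝ p u + s * r < α) ∧ α < inner ℝ p x + s * t := by
  obtain ⟨f, α, hfC, hfx⟩ := geometric_hahn_banach_closed_point hC.closure isClosed_closure hxt
  set p := (InnerProductSpace.toDual ℝ (EuclideanSpace ℝ (Fin d))).symm
    (f.comp (ContinuousLinearMap.inl ℝ (EuclideanSpace ℝ (Fin d)) ℝ)) with hp
  have hf : ∀ u r, f (u, r) = inner ℝ p u + f (0, 1) * r := by
    intro u r
    rw [hp, InnerProductSpace.toDual_symm_apply, ContinuousLinearMap.comp_apply,
      ContinuousLinearMap.inl_apply, mul_comm, ← smul_eq_mul, ← map_smul, ← map_add]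
    simp
  have hsep : ∀ u r, (u, r) ∈ C → inner ℝ p u + f (0, 1) * r < α := fun u r h => by
    rw [← hf]
    exact hfC _ (subset_closure h)
  refine ⟨p, f (0, 1), α, ?_, hsep, by rwa [← hf]⟩
  by_contra! hs
  obtain ⟨⟨u, r⟩, hur⟩ := hCne
  -- If the vertical coefficient were negative, the functional would exceed `α` far down.
  have h := hsep u (min r ((α - inner ℝ p u) / f (0, 1))) (hdown u r _ hur (min_le_left _ _))
  have h2 := mul_le_mul_of_nonpos_left (min_le_right r ((α - inner ℝ p u) / f (0, 1))) hs.le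
  rw [mul_div_cancel₀ _ hs.ne] at h2
  linarith

/-- A separating functional with positive vertical coefficient is an affine majorant. -/
theorem exists_affine_majorant_of_separation {C : Set (EuclideanSpace ℝ (Fin d) × ℝ)}
    {p x : EuclideanSpace ℝ (Fin d)} {s α t : ℝ} (hs : 0 < s)
    (hsep : ∀ u r, (u, r) ∈ C → inner ℝ p u + s * r < α) (hx : α < inner ℝ p x + s * t) :
    ∃ (θ : EuclideanSpace ℝ (Fin d)) (c : ℝ),
      (∀ u r, (u, r) ∈ C → r ≤ inner ℝ θ u + c) ∧ inner ℝ θ x + c < t := by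
  have hform : ∀ u, inner ℝ ((-s⁻¹) • p) u + s⁻¹ * α = (α - inner ℝ p u) / s := fun u => by
    rw [real_inner_smul_left]
    field_simp
    ring
  refine ⟨(-s⁻¹) • p, s⁻¹ * α, fun u r hur => ?_, ?_⟩
  · rw [hform, le_div_iff₀ hs]
    linarith [hsep u r hur]
  · rw [hform, div_lt_iff₀ hs]
    linarith

theorem exists_affine_majorant_of_concaveOn_convexHull {S : Set (EuclideanSpace ℝ (Fin d))}
    (hS : S.Nonempty) {φ : EuclideanSpace ℝ (Fin d) → ℝ}
    (hφ : ConcaveOn ℝ (convexHull ℝ S) φ) :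
    ∃ (θ : EuclideanSpace ℝ (Fin d)) (c : ℝ),
      ∀ z ∈ convexHull ℝ S, φ z ≤ inner ℝ θ z + c := by
  obtain ⟨x₀, hx₀, M, hM⟩ := exists_eventually_le_of_concaveOn_convexHull hS hφ
  have hx₀M : φ x₀ ≤ M := hM.self_of_nhds hx₀
  have hnot : (x₀, M + 1) ∉ closure {q : EuclideanSpace ℝ (Fin d) × ℝ |
      q.1 ∈ convexHull ℝ S ∧ q.2 ≤ φ q.1} := by
    rw [mem_closure_iff_frequently, Filter.not_frequently, nhds_prod_eq]
    filter_upwards [hM.prod_mk (lt_mem_nhds (lt_add_one M))] with q hq hqC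
    linarith [hq.1 hqC.1, hq.2, hqC.2]
  obtain ⟨p, s, α, hs, hsep, hx⟩ := exists_separation_of_hypograph hφ.convex_hypograph
    ⟨(x₀, φ x₀), hx₀, le_rfl⟩ (fun u r r' h hr => ⟨h.1, hr.trans h.2⟩) hnot
  -- The functional is not vertical, since it separates two points above `x₀`.
  have hs' : 0 < s := by
    refine hs.lt_of_ne fun h0 => ?_
    have := hsep x₀ (φ x₀) ⟨hx₀, le_rfl⟩
    rw [← h0] at this hx
    linarith
  obtain ⟨θ, c, hmaj, -⟩ := exists_affine_majorant_of_separation hs' hsep hx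
  exact ⟨θ, c, fun z hz => hmaj z (φ z) ⟨hz, le_rfl⟩⟩

/-- The Fenchel–Moreau theorem for hypographs: a hypograph with an affine majorant has affine
majorants that pass below any given point outside its closure. -/
theorem exists_affine_majorant_lt {C : Set (EuclideanSpace ℝ (Fin d) × ℝ)}
    (hC : Convex ℝ C) (hCne : C.Nonempty) (hdown : ∀ u r r', (u, r) ∈ C → r' ≤ r → (u, r') ∈ C)
    {θ₀ : EuclideanSpace ℝ (Fin d)} {c₀ : ℝ}
    (hmaj : ∀ u r, (u, r) ∈ C → r ≤ inner ℝ θ₀ u + c₀)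
    {x : EuclideanSpace ℝ (Fin d)} {t : ℝ} (hxt : (x, t) ∉ closure C) :
    ∃ (θ : EuclideanSpace ℝ (Fin d)) (c : ℝ),
      (∀ u r, (u, r) ∈ C → r ≤ inner ℝ θ u + c) ∧ inner ℝ θ x + c < t := by
  obtain ⟨p, s, α, hs, hsep, hx⟩ := exists_separation_of_hypograph hC hCne hdown hxt
  rcases hs.lt_or_eq with hs | rfl
  · exact exists_affine_majorant_of_separation hs hsep hx
  · simp only [zero_mul, add_zero] at hsep hx
    -- A vertical hyperplane: add a large multiple of it to the given majorant.
    obtain ⟨n, hn⟩ := exists_nat_gt ((inner ℝ θ₀ x + c₀ - t) / (inner ℝ p x - α))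
    rw [div_lt_iff₀ (by linarith)] at hn
    have hform : ∀ u, inner ℝ (θ₀ - (n : ℝ) • p) u + (c₀ + n * α) =
        inner ℝ θ₀ u + c₀ - n * (inner ℝ p u - α) := fun u => by
      rw [inner_sub_left, real_inner_smul_left]
      ring
    refine ⟨θ₀ - (n : ℝ) • p, c₀ + n * α, fun u r hur => ?_, ?_⟩
    · rw [hform]
      have := mul_nonneg n.cast_nonneg (sub_nonneg.2 (hsep u r hur).le)
      linarith [hmaj u r hur]
    · rw [hform]
      linarith

/-! ### The concave envelope and the conjugates -/

variable {g : EuclideanSpace ℝ (Fin d) → EReal} {S : Set (EuclideanSpace ℝ (Fin d))}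

theorem isConcaveFn_concEnvelope (g : EuclideanSpace ℝ (Fin d) → EReal)
    (S : Set (EuclideanSpace ℝ (Fin d))) : IsConcaveFn (concEnvelope g S) := by
  have heq : {p : EuclideanSpace ℝ (Fin d) × ℝ | (p.2 : EReal) ≤ concEnvelope g S p.1} =
      ⋂ (v : EuclideanSpace ℝ (Fin d) → EReal) (_ : IsConcaveFn v ∧ ∀ z ∈ S, g z ≤ v z),
        {p : EuclideanSpace ℝ (Fin d) × ℝ | (p.2 : EReal) ≤ v p.1} := by
    ext p
    simp only [concEnvelope, Set.mem_ofPred_eq, le_sInf_iff, Set.mem_iInter]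
    constructor
    · intro h v hv
      exact h _ ⟨v, hv.1, hv.2, rfl⟩
    · rintro h _ ⟨v, hv₁, hv₂, rfl⟩
      exact h v ⟨hv₁, hv₂⟩
  rw [IsConcaveFn, heq]
  exact convex_iInter₂ fun v hv => hv.1

theorem concEnvelope_le {v : EuclideanSpace ℝ (Fin d) → EReal} (hv : IsConcaveFn v)
    (hgv : ∀ z ∈ S, g z ≤ v z) (x : EuclideanSpace ℝ (Fin d)) : concEnvelope g S x ≤ v x :=
  sInf_le ⟨v, hv, hgv, rfl⟩

theorem le_concEnvelope {z : EuclideanSpace ℝ (Fin d)} (hz : z ∈ S) :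
    g z ≤ concEnvelope g S z := by
  refine le_sInf ?_
  rintro _ ⟨v, -, hgv, rfl⟩
  exact hgv z hz

theorem concEnvelope_le_affine {θ : EuclideanSpace ℝ (Fin d)} {c : ℝ}
    (h : ∀ z ∈ S, g z ≤ ((inner ℝ θ z + c : ℝ) : EReal)) (x : EuclideanSpace ℝ (Fin d)) :
    concEnvelope g S x ≤ ((inner ℝ θ x + c : ℝ) : EReal) := by
  refine concEnvelope_le (v := fun x => ((inner ℝ θ x + c : ℝ) : EReal)) ?_ h x
  rintro ⟨u, r⟩ hu ⟨u', r'⟩ hu' a b ha hb hab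
  simp only [Set.mem_ofPred_eq, EReal.coe_le_coe_iff] at hu hu' ⊢
  simp only [Prod.smul_mk, Prod.mk_add_mk, smul_eq_mul, inner_add_right, real_inner_smul_right]
  have hc : c = a * c + b * c := by rw [← add_mul, hab, one_mul]
  nlinarith [mul_le_mul_of_nonneg_left hu ha, mul_le_mul_of_nonneg_left hu' hb]

/-- The function that is `⊤` on `conv S` and `⊥` elsewhere is a concave majorant. -/
theorem concEnvelope_eq_bot {x : EuclideanSpace ℝ (Fin d)} (hx : x ∉ convexHull ℝ S) :
    concEnvelope g S x = ⊥ := by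
  classical
  have h := concEnvelope_le (g := g) (S := S)
    (v := fun z => if z ∈ convexHull ℝ S then (⊤ : EReal) else ⊥) ?_ ?_ x
  · simpa [hx] using h
  · have heq : {p : EuclideanSpace ℝ (Fin d) × ℝ |
        (p.2 : EReal) ≤ if p.1 ∈ convexHull ℝ S then (⊤ : EReal) else ⊥} =
        convexHull ℝ S ×ˢ Set.univ := by
      ext p
      by_cases hp : p.1 ∈ convexHull ℝ S <;> simp [hp]
    rw [IsConcaveFn, heq]
    exact (convex_convexHull ℝ S).prod convex_univ
  · intro z hz
    simp [subset_convexHull ℝ S hz]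

theorem indicatorFn_congr {C D : Set (EuclideanSpace ℝ (Fin d))}
    {x : EuclideanSpace ℝ (Fin d)} (h : x ∈ C ↔ x ∈ D) : indicatorFn C x = indicatorFn D x := by
  by_cases hx : x ∈ C
  · simp [indicatorFn, hx, h.1 hx]
  · simp [indicatorFn, hx, mt h.2 hx]

theorem concEnvelope_sub_indicatorFn (x : EuclideanSpace ℝ (Fin d)) :
    concEnvelope g S x - indicatorFn (convexHull ℝ S) x = concEnvelope g S x := by
  by_cases hx : x ∈ convexHull ℝ S
  · simp [indicatorFn, hx]
  · simp [concEnvelope_eq_bot hx]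

theorem upperClosureFn_concEnvelope_sub_indicatorFn (x : EuclideanSpace ℝ (Fin d)) :
    upperClosureFn (concEnvelope g S) x - indicatorFn (closure (convexHull ℝ S)) x =
      upperClosureFn (concEnvelope g S) x := by
  by_cases hx : x ∈ closure (convexHull ℝ S)
  · simp [indicatorFn, hx]
  · have hbot : upperClosureFn (concEnvelope g S) x = ⊥ := by
      have hev : concEnvelope g S =ᶠ[𝓝 x] fun _ => ⊥ := by
        filter_upwards [isClosed_closure.isOpen_compl.mem_nhds hx] with u hu
        exact concEnvelope_eq_bot fun h => hu (subset_closure h)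
      rw [upperClosureFn, Filter.limsup_congr hev, Filter.limsup_const]
    rw [hbot, EReal.bot_sub]

/-- The upper closure of the concave envelope is the infimum of the affine majorants. -/
theorem upperClosureFn_concEnvelope_eq (hS : S.Nonempty) (hg : ∀ z, g z ≠ ⊥)
    {θ₀ : EuclideanSpace ℝ (Fin d)} {c₀ : ℝ}
    (hmaj : ∀ z ∈ S, g z ≤ ((inner ℝ θ₀ z + c₀ : ℝ) : EReal)) (x : EuclideanSpace ℝ (Fin d)) :
    upperClosureFn (concEnvelope g S) x =
      sInf (Real.toEReal '' {r : ℝ | ∃ θ : EuclideanSpace ℝ (Fin d),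
        ∀ z ∈ S, g z ≤ ((r + inner ℝ θ (z - x) : ℝ) : EReal)}) := by
  have hshift : ∀ (θ z : EuclideanSpace ℝ (Fin d)) (r : ℝ),
      r + inner ℝ θ (z - x) = inner ℝ θ z + (r - inner ℝ θ x) := fun θ z r => by
    rw [inner_sub_right]
    ring
  apply le_antisymm
  · refine le_sInf ?_
    rintro _ ⟨r, ⟨θ, hθ⟩, rfl⟩
    simp only [hshift] at hθ
    have hlim : Filter.Tendsto (fun u => ((inner ℝ θ u + (r - inner ℝ θ x) : ℝ) : EReal)) (𝓝 x)
        (𝓝 (r : EReal)) := by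
      have hcont : Continuous fun u => ((inner ℝ θ u + (r - inner ℝ θ x) : ℝ) : EReal) :=
        continuous_coe_real_ereal.comp (by fun_prop)
      have h := hcont.tendsto x
      rwa [add_sub_cancel] at h
    rw [← hlim.limsup_eq]
    exact Filter.limsup_le_limsup (Filter.Eventually.of_forall (concEnvelope_le_affine hθ))
  · refine EReal.le_of_forall_lt_iff_le.1 fun t ht => ?_
    obtain ⟨t', ht', ht't⟩ := EReal.lt_iff_exists_real_btwn.1 ht
    have hnot : (x, t) ∉ closure {p : EuclideanSpace ℝ (Fin d) × ℝ |
        (p.2 : EReal) ≤ concEnvelope g S p.1} := by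
      rw [mem_closure_iff_frequently, Filter.not_frequently, nhds_prod_eq]
      filter_upwards [(Filter.eventually_lt_of_limsup_lt ht').prod_mk
        (lt_mem_nhds (EReal.coe_lt_coe_iff.1 ht't))] with q hq hqC
      exact (hqC.trans_lt hq.1).not_gt (EReal.coe_lt_coe_iff.2 hq.2)
    obtain ⟨z₀, hz₀⟩ := hS
    have hne : {p : EuclideanSpace ℝ (Fin d) × ℝ |
        (p.2 : EReal) ≤ concEnvelope g S p.1}.Nonempty :=
      ⟨(z₀, (g z₀).toReal), (EReal.coe_toReal_le (hg z₀)).trans (le_concEnvelope hz₀)⟩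
    obtain ⟨θ, c, hθ, hlt⟩ := exists_affine_majorant_lt (isConcaveFn_concEnvelope g S) hne
      (fun u r r' h hr => (EReal.coe_le_coe_iff.2 hr).trans h)
      (fun u r h => EReal.coe_le_coe_iff.1 (h.trans (concEnvelope_le_affine hmaj u))) hnot
    refine sInf_le_of_le (Set.mem_image_of_mem _ ⟨θ, fun z hz => ?_⟩)
      (EReal.coe_le_coe_iff.2 hlt.le)
    rw [hshift, add_sub_cancel_left]
    refine EReal.ge_of_forall_gt_iff_ge.1 fun r hr => ?_
    exact EReal.coe_le_coe_iff.2 (hθ z r (hr.le.trans (le_concEnvelope hz)))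

theorem fenchelConj_negRestrict (g : EuclideanSpace ℝ (Fin d) → EReal)
    (S : Set (EuclideanSpace ℝ (Fin d))) (θ : EuclideanSpace ℝ (Fin d)) :
    fenchelConj (negRestrict g S) (-θ) = ⨆ z ∈ S, (g z - ((inner ℝ θ z : ℝ) : EReal)) := by
  refine iSup_congr fun z => ?_
  by_cases hz : z ∈ S
  · simp only [negRestrict, hz, if_true, iSup_pos, inner_neg_left, EReal.coe_neg,
      sub_eq_add_neg, neg_neg]
    exact add_comm _ _
  · simp [negRestrict, hz]

/-- The negative biconjugate is the infimum of the affine majorants. -/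
theorem neg_fenchelConj_fenchelConj (g : EuclideanSpace ℝ (Fin d) → EReal)
    (S : Set (EuclideanSpace ℝ (Fin d))) (x : EuclideanSpace ℝ (Fin d)) :
    -fenchelConj (fenchelConj (negRestrict g S)) x =
      sInf (Real.toEReal '' {r : ℝ | ∃ θ : EuclideanSpace ℝ (Fin d),
        ∀ z ∈ S, g z ≤ ((r + inner ℝ θ (z - x) : ℝ) : EReal)}) := by
  have hiff : ∀ (θ : EuclideanSpace ℝ (Fin d)) (r : ℝ),
      (∀ z ∈ S, g z ≤ ((r + inner ℝ θ (z - x) : ℝ) : EReal)) ↔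
        fenchelConj (negRestrict g S) (-θ) ≤ ((r - inner ℝ θ x : ℝ) : EReal) := by
    intro θ r
    rw [fenchelConj_negRestrict, iSup₂_le_iff]
    refine forall₂_congr fun z _ => ?_
    rw [sub_coe_le_coe_iff, inner_sub_right, sub_add_eq_add_sub, add_sub_assoc]
  -- A bound on one term of the biconjugate is a bound on the corresponding value of `f*`.
  have hterm : ∀ (θ : EuclideanSpace ℝ (Fin d)) (r : ℝ),
      ((-r : ℝ) : EReal) ≤
          ((inner ℝ x (-θ) : ℝ) : EReal) - fenchelConj (negRestrict g S) (-θ) ↔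
        fenchelConj (negRestrict g S) (-θ) ≤ ((r - inner ℝ θ x : ℝ) : EReal) := by
    intro θ r
    rw [inner_neg_right, real_inner_comm]
    generalize fenchelConj (negRestrict g S) (-θ) = e
    induction e with
    | bot => simp
    | top => simp [-EReal.coe_sub]
    | coe e =>
      rw [← EReal.coe_sub, EReal.coe_le_coe_iff, EReal.coe_le_coe_iff]
      constructor <;> intro h <;> linarith
  apply le_antisymm
  · refine le_sInf ?_
    rintro _ ⟨r, ⟨θ, hθ⟩, rfl⟩
    rw [EReal.neg_le, ← EReal.coe_neg]
    exact ((hterm θ r).2 ((hiff θ r).1 hθ)).trans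
      (le_iSup (fun z => ((inner ℝ x z : ℝ) : EReal) - fenchelConj (negRestrict g S) z) (-θ))
  · rw [EReal.le_neg]
    refine iSup_le fun z => EReal.le_neg.1 ?_
    refine EReal.le_of_forall_lt_iff_le.1 fun r hr => sInf_le ⟨r, ⟨-z, ?_⟩, rfl⟩
    rw [hiff, ← hterm, neg_neg, EReal.coe_neg, EReal.neg_le]
    exact hr.le

end Convex

end QuasiSure

/-! ### Prices, conjugates and envelopes for a random claim -/

theorem mainTheorem3
    {Ω Ω' : Type*}
    [TopologicalSpace Ω] [PolishSpace Ω] [MeasurableSpace Ω] [BorelSpace Ω]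
    [TopologicalSpace Ω'] [PolishSpace Ω'] [MeasurableSpace Ω'] [BorelSpace Ω']
    {d : ℕ}
    (𝔓 : Ω → Set (ProbabilityMeasure Ω'))
    (h𝔓_nonempty : ∀ ω, (𝔓 ω).Nonempty)
    (h𝔓_analytic : AnalyticSet {p : Ω × ProbabilityMeasure Ω' | p.2 ∈ 𝔓 p.1})
    (y : Ω → EuclideanSpace ℝ (Fin d)) (hy : Measurable y) (hy_nonneg : ∀ ω i, 0 ≤ y ω i)
    (Y : Ω → Ω' → EuclideanSpace ℝ (Fin d))
    (hY : Measurable fun p : Ω × Ω' => Y p.1 p.2) (hY_nonneg : ∀ ω ω' i, 0 ≤ Y ω ω' i)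
    (hY_supp : ∀ ω, (QuasiSure.qsSupport (𝔓 ω) (Y ω)).Nonempty)
    (g : Ω → EuclideanSpace ℝ (Fin d) → EReal)
    (hg_usa : QuasiSure.IsUSA fun p : Ω × EuclideanSpace ℝ (Fin d) => g p.1 p.2)
    (hg_bot : ∀ ω z, g ω z ≠ ⊥)
    (ω : Ω) :
    -- the set of super-hedging prices
    QuasiSure.superHedgingPrices (𝔓 ω) (y ω) (Y ω) (fun ω' => g ω (Y ω ω')) =
      Real.toEReal ⁻¹'
        (Set.range (fun θ : EuclideanSpace ℝ (Fin d) =>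
            QuasiSure.qsEssSup (𝔓 ω)
              (fun ω' => g ω (Y ω ω') - ((inner ℝ θ (Y ω ω') : ℝ) : EReal)) +
            ((inner ℝ θ (y ω) : ℝ) : EReal)) +
          Real.toEReal '' Set.Ici 0) ∧
    (LowerSemicontinuous (g ω) →
      -- the essential supremum is a supremum over the support and a Fenchel conjugate
      (∀ θ : EuclideanSpace ℝ (Fin d),
        QuasiSure.qsEssSup (𝔓 ω)
            (fun ω' => g ω (Y ω ω') - ((inner ℝ θ (Y ω ω') : ℝ) : EReal)) =
          ⨆ z ∈ QuasiSure.qsSupport (𝔓 ω) (Y ω), (g ω z - ((inner ℝ θ z : ℝ) : EReal)) ∧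
        (⨆ z ∈ QuasiSure.qsSupport (𝔓 ω) (Y ω), (g ω z - ((inner ℝ θ z : ℝ) : EReal))) =
          QuasiSure.fenchelConj
            (QuasiSure.negRestrict (g ω) (QuasiSure.qsSupport (𝔓 ω) (Y ω))) (-θ)) ∧
      -- the infimum super-hedging cost
      (QuasiSure.IsProperFn (g ω) →
        (∃ φ : EuclideanSpace ℝ (Fin d) → ℝ,
          ConcaveOn ℝ (convexHull ℝ (QuasiSure.qsSupport (𝔓 ω) (Y ω))) φ ∧
          ∀ z ∈ convexHull ℝ (QuasiSure.qsSupport (𝔓 ω) (Y ω)), g ω z ≤ (φ z : EReal)) →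
        QuasiSure.superHedgingCost (𝔓 ω) (y ω) (Y ω) (fun ω' => g ω (Y ω ω')) =
          -QuasiSure.fenchelConj (QuasiSure.fenchelConj
            (QuasiSure.negRestrict (g ω) (QuasiSure.qsSupport (𝔓 ω) (Y ω)))) (y ω) ∧
        QuasiSure.superHedgingCost (𝔓 ω) (y ω) (Y ω) (fun ω' => g ω (Y ω ω')) =
          QuasiSure.upperClosureFn (fun x =>
            QuasiSure.concEnvelope (g ω) (QuasiSure.qsSupport (𝔓 ω) (Y ω)) x -
            QuasiSure.indicatorFn (convexHull ℝ (QuasiSure.qsSupport (𝔓 ω) (Y ω))) x) (y ω) ∧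
        QuasiSure.superHedgingCost (𝔓 ω) (y ω) (Y ω) (fun ω' => g ω (Y ω ω')) =
          QuasiSure.upperClosureFn
            (QuasiSure.concEnvelope (g ω) (QuasiSure.qsSupport (𝔓 ω) (Y ω))) (y ω) -
          QuasiSure.indicatorFn
            (closure (convexHull ℝ (QuasiSure.qsSupport (𝔓 ω) (Y ω)))) (y ω) ∧
        ((y ω ∈ closure (convexHull ℝ (QuasiSure.qsSupport (𝔓 ω) (Y ω))) →
            y ω ∈ convexHull ℝ (QuasiSure.qsSupport (𝔓 ω) (Y ω))) →
          QuasiSure.superHedgingCost (𝔓 ω) (y ω) (Y ω) (fun ω' => g ω (Y ω ω')) =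
            QuasiSure.upperClosureFn
              (QuasiSure.concEnvelope (g ω) (QuasiSure.qsSupport (𝔓 ω) (Y ω))) (y ω) -
            QuasiSure.indicatorFn
              (convexHull ℝ (QuasiSure.qsSupport (𝔓 ω) (Y ω))) (y ω)))) := by
  refine ⟨QuasiSure.superHedgingPrices_eq (h𝔓_nonempty ω) fun ω' => hg_bot ω _, fun hlsc => ?_⟩
  have hYω : Measurable (Y ω) := hY.comp measurable_prodMk_left
  refine ⟨fun θ => ⟨?_, (QuasiSure.fenchelConj_negRestrict _ _ θ).symm⟩, ?_⟩
  · exact QuasiSure.qsEssSup_eq_iSup_qsSupport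
      (h := fun z => g ω z - ((inner ℝ θ z : ℝ) : EReal)) hYω
      (QuasiSure.lowerSemicontinuous_sub_coe hlsc (by fun_prop))
  · rintro - ⟨φ, hφ, hgφ⟩
    obtain ⟨θ₀, c₀, hmaj⟩ :=
      QuasiSure.exists_affine_majorant_of_concaveOn_convexHull (hY_supp ω) hφ
    have hmaj' : ∀ z ∈ QuasiSure.qsSupport (𝔓 ω) (Y ω),
        g ω z ≤ ((inner ℝ θ₀ z + c₀ : ℝ) : EReal) := fun z hz =>
      (hgφ z (subset_convexHull ℝ _ hz)).trans
        (EReal.coe_le_coe_iff.2 (hmaj z (subset_convexHull ℝ _ hz)))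
    have hcost : QuasiSure.superHedgingCost (𝔓 ω) (y ω) (Y ω) (fun ω' => g ω (Y ω ω')) =
        sInf (Real.toEReal '' {r : ℝ | ∃ θ : EuclideanSpace ℝ (Fin d),
          ∀ z ∈ QuasiSure.qsSupport (𝔓 ω) (Y ω),
            g ω z ≤ ((r + inner ℝ θ (z - y ω) : ℝ) : EReal)}) := by
      rw [QuasiSure.superHedgingCost]
      congr 2
      ext x
      exact QuasiSure.mem_superHedgingPrices_iff hYω hlsc x
    have hclosure := hcost.trans (QuasiSure.upperClosureFn_concEnvelope_eq (hY_supp ω)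
      (hg_bot ω) hmaj' (y ω)).symm
    have hthird := hclosure.trans
      (QuasiSure.upperClosureFn_concEnvelope_sub_indicatorFn (y ω)).symm
    refine ⟨hcost.trans (QuasiSure.neg_fenchelConj_fenchelConj _ _ _).symm, ?_, hthird,
      fun hmem => ?_⟩
    · simpa only [QuasiSure.concEnvelope_sub_indicatorFn] using hclosure
    · rwa [QuasiSure.indicatorFn_congr (D := convexHull ℝ (QuasiSure.qsSupport (𝔓 ω) (Y ω)))
        ⟨hmem, fun h => subset_closure h⟩] at hthird
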